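/- Digraphs are finite and loopless, and between two vertices $u\ne v$ each of the arcs $(u,v)$, $(v,u)$ may be present. For a digraph $D$ let $d_D^+(v)$, $d_D^-(v)$ be the out- and in-degree of $v$, let $\delta^{\pm}(D)=\min_v d_D^{\pm}(v)$ and $\delta^0(D)=\min\{\delta^+(D),\delta^-(D)\}$. For $0<p<1$ let $\mathcal D(D,p)$ be the random spanning subdigraph of $D$ obtained by retaining each arc of $D$ independently with probability $p$. A property $\mathcal P$ of digraphs is monotone increasing if it is preserved under adding arcs. The local resilience of a digraph $G$ with respect to $\mathcal P$ (where the arcless digraph does not have $\mathcal P$) is the minimum $0\le r\le 1$ such that by deleting, at each vertex $v$, at most $r\,d_G^+(v)$ out-arcs and at most $r\,d_G^-(v)$ in-arcs one can obtain a digraph not having $\mathcal P$. For a sequence $D=(D_n)$ of digraphs, $D_n$ having $n$ vertices, and a sequence $p=p(n)\in(0,1)$, the property $\mathcal P$ is $(D,p,r)$-resilient if the probability that the local resilience of $\mathcal D(D_n,p(n))$ with respect to $\mathcal P$ is at least $r$ tends to $1$ as $n\to\infty$. In the $(1:b)$ game $\mathcal P(D)$ Breaker and Maker alternately claim previously unclaimed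 arcs of $D$, Breaker moving first and claiming $b$ arcs per turn, Maker claiming one arc per turn (a player claims all remaining arcs if there are fewer than required). Maker wins as soon as he has claimed all arcs of some arc-minimal subdigraph of $D$ having property $\mathcal P$. **Theorem.** Let $0<\varepsilon\le 1/100$ be a constant, let $p=p(n)$ with $0<p(n)<1$, let $D=(D_n)$ be a sequence of digraphs with $|V(D_n)|=n$, and let $\mathcal P$ be a monotone increasing digraph property that is $(D,p,\varepsilon)$-resilient. Then for every sufficiently large integer $n$ with $$\delta^0(D_n)\ \ge\ \frac{10\ln n}{\varepsilon\, p(n)},$$ Maker has a winning strategy in the $\left(1:\left\lfloor \frac{\varepsilon}{20\,p(n)}\right\rfloor\right)$ game $\mathcal P(D_n)$. -/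

import Mathlib

/-! ### Biased Maker-Breaker games -/

namespace MakerBreaker

variable {α : Type*} [DecidableEq α]

/-- The record of the completed rounds of a play, the most recent round first. A round is a pair
(set claimed by Breaker, set claimed by Maker); Breaker moves first in every round. -/
abbrev History (α : Type*) := List (Finset α × Finset α)

/-- All elements that Breaker has claimed so far. -/
def breakerSet : History α → Finset α
  | [] => ∅
  | r :: h => r.1 ∪ breakerSet h

/-- All elements that Maker has claimed so far. -/
def makerSet : History α → Finset α
  | [] => ∅
  | r :: h => r.2 ∪ makerSet h

/-- A player with bias `k` may claim the set `A` when the elements of `C` are already claimed: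
`A` consists of exactly `k` unclaimed elements of the board `X`
(of all unclaimed elements, if fewer than `k` are left). -/
def IsMove (X : Finset α) (k : ℕ) (C A : Finset α) : Prop :=
  A ⊆ X \ C ∧ A.card = min k (X \ C).card

/-- A strategy of Breaker: his next move as a function of the completed rounds. -/
abbrev BreakerStrategy (α : Type*) := History α → Finset α

/-- A strategy of Maker: his next move as a function of the completed rounds and of the move
that Breaker has just made in the current round. -/
abbrev MakerStrategy (α : Type*) := History α → Finset α → Finset α

/-- Breaker's strategy obeys the rules of the game with bias `b` on the board `X`. -/
def BreakerStrategy.Legal (X : Finset α) (b : ℕ) (τ : BreakerStrategy α) : Prop :=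
  ∀ h, IsMove X b (breakerSet h ∪ makerSet h) (τ h)

/-- Maker's strategy obeys the rules of the game with bias `a` on the board `X`. -/
def MakerStrategy.Legal (X : Finset α) (a : ℕ) (σ : MakerStrategy α) : Prop :=
  ∀ h B, IsMove X a (breakerSet h ∪ makerSet h ∪ B) (σ h B)

/-- The first `t` rounds of the play in which Maker follows `σ` and Breaker follows `τ`.
(Once the board is exhausted, all further legal moves are empty.) -/
def play (σ : MakerStrategy α) (τ : BreakerStrategy α) : ℕ → History α
  | 0 => []
  | t + 1 => (τ (play σ τ t), σ (play σ τ t) (τ (play σ τ t))) :: play σ τ t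

/-- The `(a : b)` Maker-Breaker game on the board `X` with the family `F` of winning sets, Breaker
moving first, is Maker's win: Maker has a strategy such that, against any strategy of Breaker,
he fully occupies some winning set at some point of the play. -/
def MakerWins (X : Finset α) (F : Set (Finset α)) (a b : ℕ) : Prop :=
  ∃ σ : MakerStrategy α, MakerStrategy.Legal X a σ ∧
    ∀ τ : BreakerStrategy α, BreakerStrategy.Legal X b τ →
      ∃ t : ℕ, ∃ W ∈ F, W ⊆ makerSet (play σ τ t)

end MakerBreaker

/-! ### Directed graphs, random subdigraphs and local resilience -/

namespace DirectedResilience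

variable {V : Type*}

/-- The digraph has no loops. -/
def Loopless (D : Digraph V) : Prop := ∀ v, ¬ D.Adj v v

/-- The out-degree of `v`. -/
noncomputable def outDegree (D : Digraph V) (v : V) : ℕ := {w | D.Adj v w}.ncard

/-- The in-degree of `v`. -/
noncomputable def inDegree (D : Digraph V) (v : V) : ℕ := {w | D.Adj w v}.ncard

/-- The minimum semi-degree: the minimum of the minimum out-degree and the minimum in-degree. -/
noncomputable def minSemidegree (D : Digraph V) : ℕ :=
  min (⨅ v, outDegree D v) (⨅ v, inDegree D v)

/-- The spanning digraph with a given set of arcs. -/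
def ofArcs (S : Set (V × V)) : Digraph V where
  Adj v w := (v, w) ∈ S

open Classical in
/-- The set of arcs of a digraph. -/
noncomputable def arcs [Fintype V] (D : Digraph V) : Finset (V × V) :=
  Finset.univ.filter fun e => D.Adj e.1 e.2

/-- A property of (loopless) digraphs is monotone increasing: it is preserved under
the addition of arcs. -/
def MonotoneIncreasing (P : Digraph V → Prop) : Prop :=
  ∀ G H : Digraph V, Loopless G → Loopless H → G ≤ H → P G → P H

/-- The winning sets of the game `P(D)`: the arc sets of the
arc-minimal subdigraphs of `D` that have the property `P`. -/
def winningSets [Fintype V] (D : Digraph V) (P : Digraph V → Prop) : Set (Finset (V × V)) :=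
  {W | ∃ H : Digraph V, Minimal (fun K => K ≤ D ∧ P K) H ∧ W = arcs H}

/-- The local resilience of `G` with respect to `P`: the minimum `0 ≤ r ≤ 1` such that by deleting,
at each vertex `v`, at most `r * d⁺(v)` out-arcs and at most `r * d⁻(v)` in-arcs
(degrees in `G`) one can obtain a digraph that does not have `P`. Here `H` is the digraph of the
deleted arcs. The minimum exists whenever the arcless digraph does not have `P`, and it is `0`
if `G` itself does not have `P`. -/
noncomputable def localResilience (P : Digraph V → Prop) (G : Digraph V) : ℝ :=
  sInf {r : ℝ | 0 ≤ r ∧ r ≤ 1 ∧ ∃ H : Digraph V, H ≤ G ∧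
    (∀ v, (outDegree H v : ℝ) ≤ r * outDegree G v ∧ (inDegree H v : ℝ) ≤ r * inDegree G v) ∧
    ¬ P (G \ H)}

/-- The probability that the random subdigraph of `D`, obtained by retaining each arc
independently with probability `p`, has the property `Q`. -/
noncomputable def randomSubdigraphProb [Fintype V] (D : Digraph V) (p : unitInterval)
    (Q : Digraph V → Prop) : ℝ :=
  (ProbabilityTheory.setBernoulli (arcs D : Set (V × V)) p).real {S | Q (ofArcs S)}

/-- For a sequence `D n` of digraphs on `n` vertices and a sequence `p n` of probabilities,
the property `P` is `(D, p, r)`-resilient: asymptotically almost surely the local resilience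
of the random subdigraph of `D n` is at least `r`. -/
def Resilient (D : (n : ℕ) → Digraph (Fin n)) (p : ℕ → unitInterval) (r : ℝ)
    (P : (n : ℕ) → Digraph (Fin n) → Prop) : Prop :=
  Filter.Tendsto
    (fun n => randomSubdigraphProb (D n) (p n) fun G => r ≤ localResilience (P n) G)
    Filter.atTop (nhds 1)

end DirectedResilience

/-!
Maker simulates the random digraph while he plays: he exposes the arcs of `D` one by one, each
being a success with probability `p`, and claims the successes that are still free. The successes
that Breaker already owns are lost. If few of them lie at each vertex, compared with the number of
successes there, then resilience says that Maker's arcs still have the property.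

Every vertex has two boxes, its out-arcs and its in-arcs, so an arc lies in exactly two of the
`2 * n` boxes. In each turn Maker takes a not fully exposed box of maximal danger (Breaker's arcs in
it minus `2 * b` times the successes in it) and exposes its arcs until the first success. As in the
box game, the danger of such a box stays below `2 * b` times a harmonic number
(`sum_danger_le_of_round`). Since `2 * b ≤ ε / (10 * p)`, an arc exposed in a box is Breaker's only
about `ε / (10 * p)` times per success in the box; hence about an `ε / 10` fraction of the successes
is lost, up to fluctuations of order `log n`, which the degree condition makes small.

The coin tosses are replaced by choices of Maker, following the method of conditional expectations.
The sum of the conditional probability that the final random digraph is not resilient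
(`condProb`) and of normalized exponential moments for each box (`tilt`) is a martingale under
exposure and is below `1` at the start. Maker picks each outcome so that it does not increase
(`IsExposureSupermartingale.exists_exposure`). It is then below `1` at the end, which forces the
final digraph of successes to be resilient, with many successes and few lost ones in each box
(`makerWins_of_condProb`). This yields a deterministic strategy directly, with no appeal to the
determinacy of finite games.
-/

namespace MakerBreaker

/-! ### Winning by an invariant -/

lemma exists_isMove {α : Type*} [DecidableEq α] (X : Finset α) (k : ℕ) (C : Finset α) :
    ∃ A, IsMove X k C A :=
  Finset.exists_subset_card_eq (min_le_right k (X \ C).card)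

/-- Maker wins if he can maintain a relation `R k` between the two players' sets whose index `k`
decreases in every round and which yields a winning set at `k = 0`. No memory is needed: the index
is recovered from the number of rounds played, so Maker's reply depends on the history alone. -/
theorem makerWins_of_invariant {α : Type*} [DecidableEq α] (X : Finset α) (W : Set (Finset α))
    (b : ℕ) (R : ℕ → Finset α → Finset α → Prop) (N : ℕ) (h_init : R N ∅ ∅)
    (h_step : ∀ k β μ B, R (k + 1) β μ → B ⊆ X \ (β ∪ μ) → B.card ≤ b →
      ∃ A, IsMove X 1 (β ∪ μ ∪ B) A ∧ R k (B ∪ β) (A ∪ μ))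
    (h_end : ∀ β μ, R 0 β μ → ∃ w ∈ W, w ⊆ μ) :
    MakerWins X W 1 b := by
  classical
  -- A legal reply that keeps the relation whenever some legal reply does.
  have h_choice : ∀ (h : History α) (B : Finset α), ∃ A,
      IsMove X 1 (breakerSet h ∪ makerSet h ∪ B) A ∧
      ((∃ A', IsMove X 1 (breakerSet h ∪ makerSet h ∪ B) A' ∧
        R (N - (h.length + 1)) (B ∪ breakerSet h) (A' ∪ makerSet h)) →
        R (N - (h.length + 1)) (B ∪ breakerSet h) (A ∪ makerSet h)) := by
    intro h B
    by_cases hex : ∃ A', IsMove X 1 (breakerSet h ∪ makerSet h ∪ B) A' ∧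
        R (N - (h.length + 1)) (B ∪ breakerSet h) (A' ∪ makerSet h)
    · obtain ⟨A, hA, hR⟩ := hex
      exact ⟨A, hA, fun _ => hR⟩
    · obtain ⟨A, hA⟩ := exists_isMove X 1 (breakerSet h ∪ makerSet h ∪ B)
      exact ⟨A, hA, fun h' => absurd h' hex⟩
  choose σ hσ hσR using h_choice
  refine ⟨σ, hσ, fun τ hτ => ?_⟩
  have h_len : ∀ t, (play σ τ t).length = t := by
    intro t
    induction t with
    | zero => rfl
    | succ t ih => simp [play, ih]
  have h_inv : ∀ t ≤ N, R (N - t) (breakerSet (play σ τ t)) (makerSet (play σ τ t)) := by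
    intro t
    induction t with
    | zero => intro _; exact h_init
    | succ t ih =>
      intro ht
      have hR := ih (by omega)
      have hmove := hτ (play σ τ t)
      have hk : N - t = N - (t + 1) + 1 := by omega
      rw [hk] at hR
      have := hσR (play σ τ t) (τ (play σ τ t))
      rw [h_len] at this
      exact this (h_step _ _ _ _ hR hmove.1 (hmove.2.trans_le (min_le_left _ _)))
  have := h_inv N le_rfl
  rw [Nat.sub_self] at this
  exact ⟨N, h_end _ _ this⟩

/-! ### The box game -/

/-- One round of the box game. The numbers `D`, `D₁`, `D₂` are the dangers of the boxes before
BoxMaker's move, after it, and after BoxBreaker's reply in a most dangerous active box `i`; the sets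
`A₂ ⊆ A` consist of the active boxes. The bounds on the total danger of every set of active boxes
persist: for a set `J` that omits `i`, compare with the average over `insert i J`. -/
lemma sum_danger_le_of_round {ι : Type*} [DecidableEq ι] {m : ℕ} {c : ℝ} {D D₁ D₂ : ι → ℝ}
    {A A₂ : Finset ι} (hA : A₂ ⊆ A)
    (hD : ∀ J ⊆ A, ∑ j ∈ J, D j ≤ J.card * (c * (harmonic m - harmonic J.card)))
    (hD₁ : ∀ J ⊆ A, ∑ j ∈ J, D₁ j ≤ ∑ j ∈ J, D j + c)
    {i : ι} (hi : i ∈ A) (hmax : ∀ j ∈ A, D₁ j ≤ D₁ i)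
    (hD₂ : ∀ j ∈ A₂, D₂ j ≤ D₁ j) (hDi : i ∈ A₂ → D₂ i ≤ D₁ i - c) :
    ∀ J ⊆ A₂, ∑ j ∈ J, D₂ j ≤ J.card * (c * (harmonic m - harmonic J.card)) := by
  intro J hJ
  have hJA := hJ.trans hA
  by_cases hiJ : i ∈ J
  · have h1 := hD₁ J hJA
    have h2 := hD J hJA
    rw [← Finset.add_sum_erase _ _ hiJ] at h1 ⊢
    have h3 : ∑ j ∈ J.erase i, D₂ j ≤ ∑ j ∈ J.erase i, D₁ j :=
      Finset.sum_le_sum fun j hj => hD₂ j (hJ (Finset.mem_of_mem_erase hj))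
    linarith [hDi (hJ hiJ)]
  · have hsub : insert i J ⊆ A := Finset.insert_subset hi hJA
    have h1 := (hD₁ _ hsub).trans (add_le_add_left (hD _ hsub) c)
    rw [Finset.sum_insert hiJ, Finset.card_insert_of_notMem hiJ, harmonic_succ] at h1
    have h2 : ∑ j ∈ J, D₁ j ≤ J.card * D₁ i := by
      rw [← nsmul_eq_mul]
      exact Finset.sum_le_card_nsmul _ _ _ fun j hj => hmax j (hJA hj)
    have h3 : ∑ j ∈ J, D₂ j ≤ ∑ j ∈ J, D₁ j := Finset.sum_le_sum fun j hj => hD₂ j (hJ hj)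
    refine h3.trans ?_
    have hk : (0 : ℝ) < J.card + 1 := by positivity
    have hk0 : (0 : ℝ) ≤ J.card := by positivity
    refine le_of_mul_le_mul_left ?_ hk
    push_cast at h1
    have h4 := mul_le_mul_of_nonneg_left h1 hk0
    have h5 : (J.card : ℝ) * (((J.card : ℝ) + 1) *
        (c * ((harmonic m : ℝ) - ((harmonic J.card : ℝ) + ((J.card : ℝ) + 1)⁻¹))) + c) =
        ((J.card : ℝ) + 1) * (J.card * (c * (harmonic m - harmonic J.card))) := by
      field_simp
      ring
    linarith

/-! ### Exposing a random set adaptively -/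

/-- `Φ` does not increase on average when a new element `e` is exposed: in the states `(E, S, Q)`,
`E` is the set of exposed elements, `S ⊆ E` the set of successes and `Q ⊆ E` a set of marked
elements, and `e` may be marked or not. -/
def IsExposureSupermartingale {α : Type*} [DecidableEq α] (X : Finset α) (p : ℝ)
    (Φ : Finset α → Finset α → Finset α → ℝ) : Prop :=
  ∀ E S Q, S ⊆ E → Q ⊆ E → E ⊆ X → ∀ e ∈ X, e ∉ E → ∀ Q', Q' = Q ∨ Q' = insert e Q →
    p * Φ (insert e E) (insert e S) Q' + (1 - p) * Φ (insert e E) S Q' ≤ Φ E S Q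

/-- The elements of a box `F` can be exposed until the first success, or until none is left, with
outcomes chosen so that `Φ` does not increase. Exactly the new elements in `β` get marked. -/
lemma IsExposureSupermartingale.exists_exposure {α : Type*} [DecidableEq α] {X : Finset α} {p : ℝ}
    {Φ : Finset α → Finset α → Finset α → ℝ} (hΦ : IsExposureSupermartingale X p Φ)
    (hp0 : 0 ≤ p) (hp1 : p ≤ 1) {F : Finset α} (hF : F ⊆ X) (β : Finset α) {E S Q : Finset α}
    (hS : S ⊆ E) (hQ : Q ⊆ E) (hE : E ⊆ X) :
    ∃ E' S', E ⊆ E' ∧ E' ⊆ E ∪ F ∧ Φ E' S' (Q ∪ ((E' \ E) ∩ β)) ≤ Φ E S Q ∧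
      ((F ⊆ E' ∧ S' = S) ∨ ∃ e ∈ E' \ E, S' = insert e S) := by
  induction h : (F \ E).card generalizing E Q with
  | zero =>
    rw [Finset.card_eq_zero, Finset.sdiff_eq_empty_iff_subset] at h
    exact ⟨E, S, subset_rfl, Finset.subset_union_left, by simp, Or.inl ⟨h, rfl⟩⟩
  | succ n ih =>
    obtain ⟨e, he⟩ : (F \ E).Nonempty := by
      rw [← Finset.card_pos]; omega
    obtain ⟨heF, heE⟩ := Finset.mem_sdiff.1 he
    set Q' := Q ∪ ((insert e E \ E) ∩ β) with hQ'
    have hdiff : insert e E \ E = {e} := by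
      ext x; simp only [Finset.mem_sdiff, Finset.mem_insert, Finset.mem_singleton]
      constructor
      · tauto
      · rintro rfl; exact ⟨Or.inl rfl, heE⟩
    have hcases : Q' = Q ∨ Q' = insert e Q := by
      rw [hQ', hdiff]
      by_cases heβ : e ∈ β
      · right; rw [Finset.singleton_inter_of_mem heβ, Finset.union_comm]; rfl
      · left; rw [Finset.singleton_inter_of_notMem heβ, Finset.union_empty]
    have hmart := hΦ E S Q hS hQ hE e (hF heF) heE Q' hcases
    -- The smaller of the two continuations is at most their average.
    by_cases hsucc : Φ (insert e E) (insert e S) Q' ≤ Φ E S Q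
    · exact ⟨insert e E, insert e S, Finset.subset_insert _ _,
        Finset.insert_subset (Finset.mem_union_right _ heF) Finset.subset_union_left, hsucc,
        Or.inr ⟨e, by simp [hdiff], rfl⟩⟩
    · push Not at hsucc
      have hfail : Φ (insert e E) S Q' ≤ Φ E S Q := by
        by_contra! hcon
        rcases hp0.eq_or_lt with hp | hp
        · rw [← hp] at hmart; linarith
        · have := mul_lt_mul_of_pos_left hsucc hp
          have := mul_le_mul_of_nonneg_left hcon.le (sub_nonneg.2 hp1)
          linarith
      have hQ'E : Q' ⊆ insert e E := by
        rcases hcases with h' | h' <;> rw [h']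
        · exact hQ.trans (Finset.subset_insert _ _)
        · exact Finset.insert_subset_insert _ hQ
      obtain ⟨E', S', hEE', hE'F, hle, hout⟩ := ih (hS.trans (Finset.subset_insert e E)) hQ'E
        (Finset.insert_subset (hF heF) hE) (by
          have : F \ insert e E = (F \ E).erase e := by
            ext x; simp only [Finset.mem_sdiff, Finset.mem_insert, Finset.mem_erase]; tauto
          rw [this, Finset.card_erase_of_mem he]; omega)
      have heE' : e ∈ E' := hEE' (Finset.mem_insert_self _ _)
      refine ⟨E', S', (Finset.subset_insert _ _).trans hEE', ?_, ?_, ?_⟩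
      · refine hE'F.trans (Finset.union_subset (Finset.insert_subset ?_ ?_) ?_)
        · exact Finset.mem_union_right _ heF
        · exact Finset.subset_union_left
        · exact Finset.subset_union_right
      · refine le_trans (le_of_eq ?_) (hle.trans hfail)
        congr 1
        ext x
        simp only [hQ', Finset.mem_union, Finset.mem_inter, Finset.mem_sdiff, Finset.mem_insert]
        by_cases hx : x = e
        · subst hx; simp [heE, heE']
        · simp only [hx, false_or]; tauto
      · refine hout.imp id ?_
        rintro ⟨f, hf, rfl⟩
        refine ⟨f, ?_, rfl⟩
        simp only [Finset.mem_sdiff, Finset.mem_insert, not_or] at hf ⊢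
        exact ⟨hf.1, hf.2.2⟩

/-! ### Simulating a random set against Breaker -/

/-- The state `(E, S, Q)` of Maker's simulation is compatible with Breaker's set `β`: the marked
elements are Breaker's, the total danger of every set of not fully exposed boxes is bounded as in
the box game, and few elements of each box are marked. -/
structure IsSimulation {α ι : Type*} [DecidableEq α] [Fintype ι] (X : Finset α)
    (F : ι → Finset α) (c : ℝ) (β E S Q : Finset α) : Prop where
  exposed_subset : E ⊆ X
  success_subset : S ⊆ E
  marked_subset : Q ⊆ E
  marked_breaker : Q ⊆ β
  danger_le : ∀ J : Finset ι, (∀ j ∈ J, ¬ F j ⊆ E) →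
    ∑ j ∈ J, ((β ∩ F j).card - c * (S ∩ F j).card : ℝ) ≤
      J.card * (c * (harmonic (Fintype.card ι) - harmonic J.card))
  card_marked_le : ∀ i, ((Q ∩ F i).card : ℝ) ≤
    c * ((S ∩ F i).card + harmonic (Fintype.card ι))

/-- Adding a set `B` to Breaker's set raises the total danger by at most `2 * B.card` if every
element lies in at most two boxes. -/
lemma sum_card_inter_le_two_mul {α ι : Type*} [DecidableEq α] [Fintype ι] (F : ι → Finset α)
    (hF : ∀ e, {i | e ∈ F i}.ncard ≤ 2) (B : Finset α) (J : Finset ι) :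
    ∑ j ∈ J, (B ∩ F j).card ≤ 2 * B.card := by
  classical
  calc ∑ j ∈ J, (B ∩ F j).card = ∑ j ∈ J, ∑ e ∈ B, if e ∈ F j then 1 else 0 := by
        refine Finset.sum_congr rfl fun j _ => ?_
        rw [← Finset.filter_mem_eq_inter, Finset.card_filter]
    _ = ∑ e ∈ B, ∑ j ∈ J, if e ∈ F j then 1 else 0 := Finset.sum_comm
    _ ≤ ∑ e ∈ B, 2 := by
        refine Finset.sum_le_sum fun e _ => ?_
        rw [← Finset.card_filter]
        refine le_trans ?_ (hF e)
        rw [← Set.ncard_coe_finset]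
        exact Set.ncard_le_ncard (fun j hj => by simpa using (Finset.mem_filter.1 hj).2)
          (Set.toFinite _)
    _ = 2 * B.card := by simp [mul_comm]

/-- One round of the simulation: after Breaker's move `B`, the elements of a most dangerous box are
exposed until the first success. -/
lemma IsSimulation.exists_next {α ι : Type*} [DecidableEq α] [Fintype ι]
    {X : Finset α} {F : ι → Finset α} {b : ℕ} {β E S Q : Finset α}
    (h : IsSimulation X F (2 * b) β E S Q)
    (hFX : ∀ i, F i ⊆ X) (hF : ∀ e, {i | e ∈ F i}.ncard ≤ 2) (hcov : ∀ e ∈ X, ∃ i, e ∈ F i)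
    {p : ℝ} (hp0 : 0 ≤ p) (hp1 : p ≤ 1) {Φ : Finset α → Finset α → Finset α → ℝ}
    (hΦ : IsExposureSupermartingale X p Φ) (hEX : E ≠ X) {B : Finset α} (hB : B.card ≤ b) :
    ∃ E' S', E ⊂ E' ∧ IsSimulation X F (2 * b) (B ∪ β) E' S' (Q ∪ ((E' \ E) ∩ (B ∪ β))) ∧
      Φ E' S' (Q ∪ ((E' \ E) ∩ (B ∪ β))) ≤ Φ E S Q ∧
      (S' = S ∨ ∃ e ∈ E' \ E, S' = insert e S) := by
  classical
  set β₁ := B ∪ β with hβ₁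
  set A : Finset ι := {i | ¬ F i ⊆ E} with hA
  set D : ι → ℝ := fun j => (β ∩ F j).card - 2 * b * (S ∩ F j).card with hDdef
  set D₁ : ι → ℝ := fun j => (β₁ ∩ F j).card - 2 * b * (S ∩ F j).card with hD₁def
  have hD : ∀ J ⊆ A, ∑ j ∈ J, D j ≤
      J.card * (2 * b * (harmonic (Fintype.card ι) - harmonic J.card)) := fun J hJ =>
    h.danger_le J fun j hj => (Finset.mem_filter.1 (hJ hj)).2
  have hD₁ : ∀ J ⊆ A, ∑ j ∈ J, D₁ j ≤ ∑ j ∈ J, D j + 2 * b := by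
    intro J _
    have h1 : ∑ j ∈ J, ((B ∩ F j).card : ℝ) ≤ 2 * b := by
      have := (sum_card_inter_le_two_mul F hF B J).trans (Nat.mul_le_mul_left 2 hB)
      exact_mod_cast this
    refine le_trans ?_ (add_le_add_right h1 _)
    rw [← Finset.sum_add_distrib]
    refine Finset.sum_le_sum fun j _ => ?_
    have : (β₁ ∩ F j).card ≤ (B ∩ F j).card + (β ∩ F j).card := by
      rw [hβ₁, Finset.union_inter_distrib_right]; exact Finset.card_union_le _ _
    have : ((β₁ ∩ F j).card : ℝ) ≤ (B ∩ F j).card + (β ∩ F j).card := by exact_mod_cast this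
    simp only [hDdef, hD₁def]
    linarith
  have hAne : A.Nonempty := by
    obtain ⟨e, heX, heE⟩ := Finset.exists_of_ssubset (h.exposed_subset.ssubset_of_ne hEX)
    obtain ⟨i, hi⟩ := hcov e heX
    exact ⟨i, by simp only [hA, Finset.mem_filter, Finset.mem_univ, true_and]
                 exact fun hsub => heE (hsub hi)⟩
  obtain ⟨i, hi, hmax⟩ := Finset.exists_max_image A D₁ hAne
  have hiE : ¬ F i ⊆ E := (Finset.mem_filter.1 hi).2
  obtain ⟨E', S', hEE', hE'F, hle, hout⟩ := hΦ.exists_exposure hp0 hp1 (hFX i) β₁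
    h.success_subset h.marked_subset h.exposed_subset
  have hSS' : S ⊆ S' := by
    rcases hout with ⟨_, rfl⟩ | ⟨e, _, rfl⟩
    · exact subset_rfl
    · exact Finset.subset_insert _ _
  have hS'E' : S' ⊆ E' := by
    rcases hout with ⟨_, rfl⟩ | ⟨e, he, rfl⟩
    · exact h.success_subset.trans hEE'
    · exact Finset.insert_subset (Finset.mem_sdiff.1 he).1 (h.success_subset.trans hEE')
  have hQβ : Q ∪ ((E' \ E) ∩ β₁) ⊆ β₁ :=
    Finset.union_subset (h.marked_breaker.trans Finset.subset_union_right)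
      Finset.inter_subset_right
  have hScard : ∀ j, ((S ∩ F j).card : ℝ) ≤ (S' ∩ F j).card := fun j => by
    exact_mod_cast Finset.card_le_card (Finset.inter_subset_inter_right hSS')
  have hb : (0 : ℝ) ≤ 2 * b := by positivity
  refine ⟨E', S', ?_, ⟨?_, hS'E', ?_, hQβ, ?_, ?_⟩, hle, ?_⟩
  · refine hEE'.ssubset_of_ne ?_
    rintro rfl
    rcases hout with ⟨hF', _⟩ | ⟨e, he, _⟩
    · exact hiE hF'
    · simp at he
  · exact hE'F.trans (Finset.union_subset h.exposed_subset (hFX i))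
  · exact Finset.union_subset (h.marked_subset.trans hEE')
      (Finset.inter_subset_left.trans Finset.sdiff_subset)
  · have key := sum_danger_le_of_round (A₂ := {j | ¬ F j ⊆ E'})
      (D₂ := fun j => ((β₁ ∩ F j).card - 2 * b * (S' ∩ F j).card : ℝ)) (fun j hj => by
        simp only [hA, Finset.mem_filter, Finset.mem_univ, true_and] at hj ⊢
        exact fun hsub => hj (hsub.trans hEE')) hD hD₁ hi hmax
      (fun j _ => by
        have := mul_le_mul_of_nonneg_left (hScard j) hb
        simp only [hD₁def]; linarith)
      (fun hi' => by
        -- Box `i` is not used up, so its exposure ended with a success.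
        rcases hout with ⟨hF', _⟩ | ⟨e, he, rfl⟩
        · exact absurd hF' (Finset.mem_filter.1 hi').2
        · obtain ⟨heE', heE⟩ := Finset.mem_sdiff.1 he
          have heF : e ∈ F i := (Finset.mem_union.1 (hE'F heE')).resolve_left heE
          have hc : (insert e S ∩ F i).card = (S ∩ F i).card + 1 := by
            rw [Finset.insert_inter_of_mem heF, Finset.card_insert_of_notMem]
            exact fun hmem => heE (h.success_subset (Finset.mem_inter.1 hmem).1)
          simp only [hD₁def, hc]
          push_cast
          linarith)
    exact fun J hJ => key J fun j hj => by simpa using hJ j hj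
  · intro j
    have hmono := mul_le_mul_of_nonneg_left (hScard j) hb
    by_cases hj : F j ⊆ E
    · have : (Q ∪ ((E' \ E) ∩ β₁)) ∩ F j = Q ∩ F j := by
        ext x
        simp only [Finset.mem_inter, Finset.mem_union, Finset.mem_sdiff]
        have := @hj x
        tauto
      rw [this]
      linarith [h.card_marked_le j]
    · have hjA : {j} ⊆ A := by simpa [hA] using hj
      have h1 := (hD₁ _ hjA).trans (add_le_add_left (hD _ hjA) _)
      simp only [Finset.sum_singleton, Finset.card_singleton, hD₁def, Nat.cast_one, one_mul] at h1
      have h2 : ((harmonic 1 : ℚ) : ℝ) = 1 := by simp [harmonic]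
      rw [h2] at h1
      have h3 : (((Q ∪ ((E' \ E) ∩ β₁)) ∩ F j).card : ℝ) ≤ (β₁ ∩ F j).card := by
        exact_mod_cast Finset.card_le_card (Finset.inter_subset_inter_right hQβ)
      linarith
  · exact hout.imp And.right id

/-- Maker wins if a potential that starts below `1` certifies his goal at the end: whenever all
elements are exposed, `Φ` is below `1` and few elements of each box are marked, the unmarked
successes contain a winning set. Here the marked elements are those that belonged to Breaker when
they were exposed, so Maker owns all unmarked successes. -/
theorem makerWins_of_exposure {α ι : Type*} [DecidableEq α] [Fintype ι]
    {X : Finset α} {F : ι → Finset α} {b : ℕ}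
    (hFX : ∀ i, F i ⊆ X) (hF : ∀ e, {i | e ∈ F i}.ncard ≤ 2) (hcov : ∀ e ∈ X, ∃ i, e ∈ F i)
    {p : ℝ} (hp0 : 0 ≤ p) (hp1 : p ≤ 1) {Φ : Finset α → Finset α → Finset α → ℝ}
    (hΦ : IsExposureSupermartingale X p Φ) (hΦ0 : Φ ∅ ∅ ∅ < 1) {W : Set (Finset α)}
    (hW : ∀ S Q, S ⊆ X → Q ⊆ X → Φ X S Q < 1 →
      (∀ i, ((Q ∩ F i).card : ℝ) ≤ 2 * b * ((S ∩ F i).card + harmonic (Fintype.card ι))) →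
      ∃ w ∈ W, w ⊆ S \ Q) :
    MakerWins X W 1 b := by
  classical
  have hharm : ∀ k m : ℕ, k ≤ m → (harmonic k : ℝ) ≤ harmonic m := by
    intro k m hkm
    have : harmonic k ≤ harmonic m := by
      unfold harmonic
      exact Finset.sum_le_sum_of_subset_of_nonneg (Finset.range_mono hkm) fun _ _ _ => by positivity
    exact_mod_cast this
  refine makerWins_of_invariant X W b (fun k β μ => ∃ E S Q, IsSimulation X F (2 * b) β E S Q ∧
    Φ E S Q < 1 ∧ S \ Q ⊆ μ ∧ (X \ E).card ≤ k) X.card ?_ ?_ ?_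
  · refine ⟨∅, ∅, ∅, ⟨by simp, subset_rfl, subset_rfl, subset_rfl, ?_, ?_⟩, hΦ0, by simp, by simp⟩
    · intro J _
      have := hharm J.card _ (Finset.card_le_univ J)
      have : (0 : ℝ) ≤ J.card * (2 * b * (harmonic (Fintype.card ι) - harmonic J.card)) :=
        mul_nonneg (by positivity) (mul_nonneg (by positivity) (sub_nonneg.2 this))
      simpa using this
    · intro i
      have := hharm 0 _ (Nat.zero_le (Fintype.card ι))
      rw [harmonic_zero, Rat.cast_zero] at this
      have : (0 : ℝ) ≤ 2 * b * harmonic (Fintype.card ι) := mul_nonneg (by positivity) this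
      simpa using this
  · rintro k β μ B ⟨E, S, Q, hsim, hlt, hSμ, hk⟩ hBX hBb
    obtain ⟨A₀, hA₀⟩ := exists_isMove X 1 (β ∪ μ ∪ B)
    by_cases hEX : E = X
    · subst hEX
      refine ⟨A₀, hA₀, E, S, Q, ?_, hlt, hSμ.trans Finset.subset_union_right, by simp⟩
      refine ⟨hsim.exposed_subset, hsim.success_subset, hsim.marked_subset,
        hsim.marked_breaker.trans Finset.subset_union_right, ?_, hsim.card_marked_le⟩
      intro J hJ
      have : J = ∅ := Finset.eq_empty_of_forall_notMem fun j hj => hJ j hj (hFX j)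
      simp [this]
    · obtain ⟨E', S', hEE', hsim', hle, hout⟩ :=
        hsim.exists_next hFX hF hcov hp0 hp1 hΦ hEX hBb
      have hcard : (X \ E').card ≤ k := by
        have : (X \ E').card < (X \ E).card := by
          refine Finset.card_lt_card ?_
          refine (Finset.sdiff_subset_sdiff subset_rfl hEE'.subset).ssubset_of_ne ?_
          intro heq
          obtain ⟨e, he', he⟩ := Finset.exists_of_ssubset hEE'
          have : e ∈ X \ E := Finset.mem_sdiff.2 ⟨hsim'.exposed_subset he', he⟩
          rw [← heq] at this
          exact (Finset.mem_sdiff.1 this).2 he'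
        omega
      -- Maker claims the new success if it is free; otherwise his move does not matter.
      by_cases hfree : ∃ e ∈ E' \ E, S' = insert e S ∧ e ∉ β ∪ μ ∪ B
      · obtain ⟨e, he, rfl, heC⟩ := hfree
        have heX : e ∈ X \ (β ∪ μ ∪ B) :=
          Finset.mem_sdiff.2 ⟨hsim'.exposed_subset (Finset.mem_sdiff.1 he).1, heC⟩
        refine ⟨{e}, ⟨by simpa using heX, ?_⟩, E', _, _, hsim', hle.trans_lt hlt, ?_, hcard⟩
        · rw [Finset.card_singleton, min_eq_left (Finset.card_pos.2 ⟨e, heX⟩)]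
        · intro x hx
          simp only [Finset.mem_sdiff, Finset.mem_insert, Finset.mem_union, not_or,
            Finset.mem_singleton] at hx ⊢
          rcases hx.1 with rfl | hxS
          · exact Or.inl rfl
          · exact Or.inr (hSμ (Finset.mem_sdiff.2 ⟨hxS, hx.2.1⟩))
      · refine ⟨A₀, hA₀, E', _, _, hsim', hle.trans_lt hlt, ?_, hcard⟩
        intro x hx
        simp only [Finset.mem_sdiff, Finset.mem_union, not_or, Finset.mem_inter, not_and] at hx ⊢
        right
        rcases hout with rfl | ⟨e, he, rfl⟩
        · exact hSμ (Finset.mem_sdiff.2 ⟨hx.1, hx.2.1⟩)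
        · rcases Finset.mem_insert.1 hx.1 with rfl | hxS
          · by_contra hxμ
            refine hfree ⟨x, he, rfl, ?_⟩
            have := hx.2.2 (Finset.mem_sdiff.1 he)
            simp only [Finset.mem_union, not_or]
            tauto
          · exact hSμ (Finset.mem_sdiff.2 ⟨hxS, hx.2.1⟩)
  · rintro β μ ⟨E, S, Q, hsim, hlt, hSμ, hk⟩
    have hEX : E = X := by
      refine hsim.exposed_subset.antisymm ?_
      rw [← Finset.sdiff_eq_empty_iff_subset, ← Finset.card_eq_zero]
      omega
    subst hEX
    obtain ⟨w, hw, hwS⟩ := hW S Q hsim.success_subset hsim.marked_subset hlt hsim.card_marked_le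
    exact ⟨w, hw, hwS.trans hSμ⟩

/-! ### Potentials -/

section Potentials

variable {α : Type*} [DecidableEq α] {X : Finset α} {p : ℝ}

lemma IsExposureSupermartingale.add {Φ Ψ : Finset α → Finset α → Finset α → ℝ}
    (hΦ : IsExposureSupermartingale X p Φ) (hΨ : IsExposureSupermartingale X p Ψ) :
    IsExposureSupermartingale X p fun E S Q => Φ E S Q + Ψ E S Q := by
  intro E S Q hS hQ hE e heX heE Q' hQ'
  have h1 := hΦ E S Q hS hQ hE e heX heE Q' hQ'
  have h2 := hΨ E S Q hS hQ hE e heX heE Q' hQ'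
  simp only
  linarith

lemma IsExposureSupermartingale.const_mul {Φ : Finset α → Finset α → Finset α → ℝ}
    (hΦ : IsExposureSupermartingale X p Φ) {a : ℝ} (ha : 0 ≤ a) :
    IsExposureSupermartingale X p fun E S Q => a * Φ E S Q := by
  intro E S Q hS hQ hE e heX heE Q' hQ'
  have h1 := mul_le_mul_of_nonneg_left (hΦ E S Q hS hQ hE e heX heE Q' hQ') ha
  simp only
  linarith

lemma IsExposureSupermartingale.sum {ι : Type*} (J : Finset ι)
    {Φ : ι → Finset α → Finset α → Finset α → ℝ}
    (hΦ : ∀ i ∈ J, IsExposureSupermartingale X p (Φ i)) :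
    IsExposureSupermartingale X p fun E S Q => ∑ i ∈ J, Φ i E S Q := by
  intro E S Q hS hQ hE e heX heE Q' hQ'
  simp only
  rw [Finset.mul_sum, Finset.mul_sum, ← Finset.sum_add_distrib]
  exact Finset.sum_le_sum fun i hi => hΦ i hi E S Q hS hQ hE e heX heE Q' hQ'

/-- The exponential moment of the number `k` of successes among `m` exposed elements, normalized by
its expectation. -/
noncomputable def tilt (x p : ℝ) (k m : ℕ) : ℝ := x ^ k / (1 + (x - 1) * p) ^ m

lemma tilt_average {x p : ℝ} (hx : 0 < 1 + (x - 1) * p) (k m : ℕ) :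
    p * tilt x p (k + 1) (m + 1) + (1 - p) * tilt x p k (m + 1) = tilt x p k m := by
  have h : p * x + (1 - p) = 1 + (x - 1) * p := by ring
  unfold tilt
  rw [← mul_div_assoc, ← mul_div_assoc, ← add_div, div_eq_div_iff (by positivity) (by positivity),
    pow_succ (1 + (x - 1) * p), ← h]
  ring

/-- A tilt below `y` bounds the number of successes; this is the Chernoff bound. -/
lemma mul_log_lt_of_tilt_lt {x p y : ℝ} {k m : ℕ} (hx0 : 0 < x) (hx : 0 < 1 + (x - 1) * p)
    (h : tilt x p k m < y) : k * Real.log x < Real.log y + m * ((x - 1) * p) := by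
  have hpow : 0 < (1 + (x - 1) * p) ^ m := pow_pos hx m
  have hy : 0 < y := lt_of_le_of_lt (by unfold tilt; positivity) h
  rw [tilt, div_lt_iff₀ hpow] at h
  have h1 := Real.log_lt_log (pow_pos hx0 k) h
  rw [Real.log_mul hy.ne' hpow.ne', Real.log_pow, Real.log_pow] at h1
  have h2 := mul_le_mul_of_nonneg_left (Real.log_le_sub_one_of_pos hx) (Nat.cast_nonneg (α := ℝ) m)
  linarith

/-- The tilt that counts all successes in a box `F`. -/
lemma isExposureSupermartingale_tilt {x : ℝ} (hx : 0 < 1 + (x - 1) * p) (F : Finset α) :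
    IsExposureSupermartingale X p fun E S _ => tilt x p (S ∩ F).card (E ∩ F).card := by
  intro E S Q hS _ _ e _ heE Q' _
  have heS : e ∉ S := fun h => heE (hS h)
  by_cases heF : e ∈ F
  · simp only [Finset.insert_inter_of_mem heF]
    rw [Finset.card_insert_of_notMem (by simp [heS]), Finset.card_insert_of_notMem (by simp [heE]),
      tilt_average hx]
  · simp only [Finset.insert_inter_of_notMem heF]
    linarith

/-- The tilt that counts the successes among the marked elements of a box `F`. -/
lemma isExposureSupermartingale_tilt_marked {x : ℝ} (hx : 0 < 1 + (x - 1) * p) (F : Finset α) :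
    IsExposureSupermartingale X p fun _ S Q => tilt x p (S ∩ Q ∩ F).card (Q ∩ F).card := by
  intro E S Q hS hQ _ e _ heE Q' hQ'
  have heS : e ∉ S := fun h => heE (hS h)
  have heQ : e ∉ Q := fun h => heE (hQ h)
  rcases hQ' with rfl | rfl
  · simp only [Finset.insert_inter_of_notMem heQ]
    linarith
  · simp only [← Finset.insert_inter_distrib, Finset.inter_insert_of_notMem heS]
    by_cases heF : e ∈ F
    · simp only [Finset.insert_inter_of_mem heF]
      rw [Finset.card_insert_of_notMem (by simp [heS]),
        Finset.card_insert_of_notMem (by simp [heQ]), tilt_average hx]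
    · simp only [Finset.insert_inter_of_notMem heF]
      linarith

open Classical in
/-- The conditional probability that the `p`-random subset of `X` satisfies `G`, given that its
intersection with the exposed set `E` is `S`. -/
noncomputable def condProb (X : Finset α) (p : ℝ) (G : Finset α → Prop) (E S : Finset α) : ℝ :=
  ∑ T ∈ (X \ E).powerset, if G (S ∪ T) then p ^ T.card * (1 - p) ^ ((X \ E) \ T).card else 0

lemma condProb_average (G : Finset α → Prop) {E S : Finset α} {e : α} (heX : e ∈ X) (heE : e ∉ E) :
    p * condProb X p G (insert e E) (insert e S) + (1 - p) * condProb X p G (insert e E) S =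
      condProb X p G E S := by
  classical
  have hins : X \ E = insert e (X \ insert e E) := by
    ext x; simp only [Finset.mem_sdiff, Finset.mem_insert]
    by_cases hx : x = e
    · subst hx; simp [heX, heE]
    · simp [hx]
  have he : e ∉ X \ insert e E := by simp
  unfold condProb
  rw [hins, Finset.sum_powerset_insert he, add_comm, Finset.mul_sum, Finset.mul_sum]
  congr 1
  · refine Finset.sum_congr rfl fun T hT => ?_
    have heT : e ∉ T := fun h => he (Finset.mem_powerset.1 hT h)
    rw [Finset.insert_sdiff_of_notMem _ heT, Finset.card_insert_of_notMem (by simp)]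
    split_ifs
    · ring
    · ring
  · refine Finset.sum_congr rfl fun T hT => ?_
    have heT : e ∉ T := fun h => he (Finset.mem_powerset.1 hT h)
    have hsd : insert e (X \ insert e E) \ insert e T = (X \ insert e E) \ T := by
      ext x; simp only [Finset.mem_sdiff, Finset.mem_insert]; tauto
    rw [hsd, Finset.card_insert_of_notMem heT, Finset.union_insert, Finset.insert_union]
    split_ifs
    · ring
    · ring

lemma isExposureSupermartingale_one_sub_condProb (G : Finset α → Prop) :
    IsExposureSupermartingale X p fun E S _ => 1 - condProb X p G E S := by
  intro E S _ _ _ _ e heX heE _ _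
  have := condProb_average (p := p) G (S := S) heX heE
  simp only
  linarith

open Classical in
lemma condProb_self (G : Finset α → Prop) (S : Finset α) :
    condProb X p G X S = if G S then 1 else 0 := by
  simp [condProb]

lemma setBernoulli_real_eq_condProb [Countable α] (p : unitInterval) (G : Set α → Prop) :
    (ProbabilityTheory.setBernoulli (X : Set α) p).real {S | G S} =
      condProb X p (fun S => G S) ∅ ∅ := by
  classical
  have hset : {S | S ∈ {S | G S} ∧ S ⊆ (X : Set α)} =
      ⋃ T ∈ X.powerset.filter (fun T : Finset α => G (T : Set α)), {(T : Set α)} := by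
    ext S
    simp only [Set.mem_ofPred_eq, Set.mem_iUnion, Set.mem_singleton_iff, Finset.mem_filter,
      Finset.mem_powerset, exists_prop]
    constructor
    · rintro ⟨hG, hS⟩
      lift S to Finset α using X.finite_toSet.subset hS
      exact ⟨S, ⟨by exact_mod_cast hS, hG⟩, rfl⟩
    · rintro ⟨T, ⟨hT, hG⟩, rfl⟩
      exact ⟨hG, by exact_mod_cast hT⟩
  rw [MeasureTheory.measureReal_def, ProbabilityTheory.setBernoulli_apply_eq_apply_subsets,
    ← MeasureTheory.measureReal_def, hset,
    MeasureTheory.measureReal_biUnion_finset (by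
      intro A _ B _ hAB
      simpa [Function.onFun] using hAB) (by simp), condProb, Finset.sum_filter, Finset.sdiff_empty]
  refine Finset.sum_congr rfl fun T hT => ?_
  rw [Finset.empty_union]
  split_ifs
  · have hT' : (T : Set α) ⊆ X := by exact_mod_cast Finset.mem_powerset.1 hT
    rw [ProbabilityTheory.setBernoulli_real_singleton p hT' X.finite_toSet, Set.ncard_coe_finset,
      ← Finset.coe_sdiff, Set.ncard_coe_finset]
  · rfl

end Potentials

/-- Suppose that `ℓ` is small compared with the expected number `p * |F i|` of successes in every
box, and that the `p`-random subset of `X` is good with probability more than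
`2 * |ι| * exp (-2 * ℓ)`. If every good set `S`, after the removal of a part `Z` that takes at most
a proportion `19 / 20 * ε` of each box, still contains a winning set, then Maker wins.

The potential is the conditional probability of a bad outcome plus, for each box, two tilts of
weight `exp (-2 * ℓ)`: one penalizes few successes in the box, the other many marked successes. -/
theorem makerWins_of_condProb {α ι : Type*} [DecidableEq α] [Fintype ι]
    {X : Finset α} {F : ι → Finset α} {b : ℕ}
    (hFX : ∀ i, F i ⊆ X) (hF : ∀ e, {i | e ∈ F i}.ncard ≤ 2) (hcov : ∀ e ∈ X, ∃ i, e ∈ F i)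
    {p ε ℓ : ℝ} (hp0 : 0 < p) (hp1 : p ≤ 1) (hε0 : 0 < ε) (hε1 : ε ≤ 1 / 100)
    (hb : b * (20 * p) ≤ ε) (hsize : ∀ i, 10 * ℓ ≤ ε * (p * (F i).card))
    (hℓ : (harmonic (Fintype.card ι) : ℝ) ≤ 2 * ℓ)
    {G : Finset α → Prop} (hG : 2 * Fintype.card ι * Real.exp (-2 * ℓ) < condProb X p G ∅ ∅)
    {W : Set (Finset α)}
    (hW : ∀ S ⊆ X, G S → ∀ Z ⊆ S,
      (∀ i, ((Z ∩ F i).card : ℝ) ≤ 19 / 20 * ε * (S ∩ F i).card) → ∃ w ∈ W, w ⊆ S \ Z) :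
    MakerWins X W 1 b := by
  classical
  have he1 := Real.exp_one_gt_d9
  have he2 := Real.exp_one_lt_d9
  have he3 : Real.exp (-1) < 0.37 := by
    rw [Real.exp_neg, inv_lt_comm₀ (Real.exp_pos 1) (by norm_num)]
    linarith
  have hx1 : 0 < 1 + (Real.exp 1 - 1) * p := by nlinarith
  have hx2 : 0 < 1 + (Real.exp (-1) - 1) * p := by nlinarith [Real.exp_pos (-1)]
  set a := Real.exp (-2 * ℓ) with ha
  have ha0 : 0 < a := Real.exp_pos _
  have htilt : ∀ x : ℝ, 0 < x → 0 < 1 + (x - 1) * p → ∀ k m : ℕ, 0 ≤ tilt x p k m :=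
    fun x hx hx' k m => by unfold tilt; positivity
  -- A tilt of weight `a` contributing less than `1` stays below `exp (2 * ℓ)`.
  have hbound : ∀ x : ℝ, 0 < x → 0 < 1 + (x - 1) * p → ∀ k m : ℕ, a * tilt x p k m < 1 →
      k * Real.log x < 2 * ℓ + m * ((x - 1) * p) := by
    intro x hx hx' k m h
    have h' : tilt x p k m < Real.exp (2 * ℓ) := by
      rw [ha, neg_mul, Real.exp_neg, inv_mul_lt_iff₀ (Real.exp_pos _), mul_one] at h
      exact h
    have := mul_log_lt_of_tilt_lt hx hx' h'
    rwa [Real.log_exp] at this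
  refine makerWins_of_exposure (Φ := fun E S Q => (1 - condProb X p G E S) +
    ∑ i, a * (tilt (Real.exp (-1)) p (S ∩ F i).card (E ∩ F i).card +
      tilt (Real.exp 1) p (S ∩ Q ∩ F i).card (Q ∩ F i).card)) hFX hF hcov hp0.le hp1 ?_ ?_ ?_
  · exact (isExposureSupermartingale_one_sub_condProb G).add (.sum _ fun i _ =>
      ((isExposureSupermartingale_tilt hx2 _).add
        (isExposureSupermartingale_tilt_marked hx1 _)).const_mul ha0.le)
  · simp only [Finset.empty_inter, Finset.card_empty, tilt, pow_zero, div_one, Finset.sum_const,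
      Finset.card_univ, nsmul_eq_mul]
    linarith
  · intro S Q hS hQ hlt hmarked
    have hterm : ∀ i, 0 ≤ a * (tilt (Real.exp (-1)) p (S ∩ F i).card (X ∩ F i).card +
        tilt (Real.exp 1) p (S ∩ Q ∩ F i).card (Q ∩ F i).card) := fun i =>
      mul_nonneg ha0.le (add_nonneg (htilt _ (Real.exp_pos _) hx2 _ _)
        (htilt _ (Real.exp_pos _) hx1 _ _))
    have hsum := Finset.sum_nonneg fun i (_ : i ∈ Finset.univ) => hterm i
    have hGS : G S := by
      by_contra hcon
      simp only [condProb_self, if_neg hcon] at hlt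
      linarith
    simp only [condProb_self, if_pos hGS, sub_self, zero_add] at hlt
    obtain ⟨w, hw, hwS⟩ := hW S hS hGS (S ∩ Q) Finset.inter_subset_left (fun i => by
      have hi := (Finset.single_le_sum (fun i _ => hterm i) (Finset.mem_univ i)).trans_lt hlt
      rw [mul_add] at hi
      have ht1 := mul_nonneg ha0.le (htilt _ (Real.exp_pos _) hx2 (S ∩ F i).card (X ∩ F i).card)
      have ht2 := mul_nonneg ha0.le
        (htilt _ (Real.exp_pos _) hx1 (S ∩ Q ∩ F i).card (Q ∩ F i).card)
      have h1 := hbound _ (Real.exp_pos _) hx2 (S ∩ F i).card (X ∩ F i).card (by linarith)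
      have h2 := hbound _ (Real.exp_pos _) hx1 (S ∩ Q ∩ F i).card (Q ∩ F i).card (by linarith)
      rw [Real.log_exp, Finset.inter_eq_right.2 (hFX i)] at h1
      rw [Real.log_exp] at h2
      set s : ℝ := ((S ∩ F i).card : ℝ)
      set q : ℝ := ((Q ∩ F i).card : ℝ)
      set d : ℝ := ((F i).card : ℝ)
      set z : ℝ := ((S ∩ Q ∩ F i).card : ℝ)
      have hs0 : 0 ≤ s := by positivity
      have hq0 : 0 ≤ q := by positivity
      have hpd0 : 0 ≤ p * d := by positivity
      have hℓd := hsize i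
      have hmi := hmarked i
      -- The number of successes is at least `0.62 * p * d`.
      have h3 : 0.63 * (p * d) - 2 * ℓ ≤ s := by nlinarith
      have h4 : 10 * ℓ ≤ 1 / 100 * (p * d) :=
        hℓd.trans (mul_le_mul_of_nonneg_right hε1 hpd0)
      have h5 : 0.62 * (p * d) ≤ s := by linarith
      have h6 : 6.2 * ℓ ≤ ε * s := by nlinarith
      -- The number of marked elements is at most `ε / (10 * p)` times the number of successes,
      -- up to a lower order term.
      have h7 : p * q ≤ ε / 10 * (s + 2 * ℓ) := by
        have hsl : 0 ≤ s + 2 * ℓ := by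
          have : (0 : ℝ) ≤ harmonic (Fintype.card ι) := by
            have : (0 : ℚ) ≤ harmonic (Fintype.card ι) := by
              unfold harmonic; positivity
            exact_mod_cast this
          linarith
        have h8 : q ≤ 2 * b * (s + 2 * ℓ) :=
          hmi.trans (mul_le_mul_of_nonneg_left (by linarith) (by positivity))
        have h9 := mul_le_mul_of_nonneg_left h8 hp0.le
        have h10 := mul_le_mul_of_nonneg_right hb hsl
        linarith
      have h8 : q * ((Real.exp 1 - 1) * p) ≤ 1.72 * (p * q) := by
        have : 0 ≤ p * q := by positivity
        nlinarith
      have h9 : 0 ≤ ε * s := mul_nonneg hε0.le hs0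
      have h10 : ε * (2 * ℓ) ≤ ε * s := mul_le_mul_of_nonneg_left (by linarith) hε0.le
      linarith)
    exact ⟨w, hw, hwS.trans (by
      intro x hx
      simp only [Finset.mem_sdiff, Finset.mem_inter] at hx ⊢
      tauto)⟩

end MakerBreaker

namespace DirectedResilience

/-! ### Digraphs -/

variable {V : Type*}

lemma mem_arcs [Fintype V] {D : Digraph V} {e : V × V} : e ∈ arcs D ↔ D.Adj e.1 e.2 := by
  simp [arcs]

lemma outDegree_eq_ncard (D : Digraph V) (v : V) :
    outDegree D v = {e : V × V | D.Adj e.1 e.2 ∧ e.1 = v}.ncard := by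
  have : {e : V × V | D.Adj e.1 e.2 ∧ e.1 = v} = (fun w => (v, w)) '' {w | D.Adj v w} := by
    ext ⟨x, y⟩
    simp only [Set.mem_ofPred_eq, Set.mem_image, Prod.mk.injEq]
    constructor
    · rintro ⟨h, rfl⟩; exact ⟨y, h, rfl, rfl⟩
    · rintro ⟨w, h, rfl, rfl⟩; exact ⟨h, rfl⟩
  rw [this, Set.ncard_image_of_injective _ (Prod.mk_right_injective v)]
  rfl

lemma inDegree_eq_ncard (D : Digraph V) (v : V) :
    inDegree D v = {e : V × V | D.Adj e.1 e.2 ∧ e.2 = v}.ncard := by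
  have : {e : V × V | D.Adj e.1 e.2 ∧ e.2 = v} = (fun w => (w, v)) '' {w | D.Adj w v} := by
    ext ⟨x, y⟩
    simp only [Set.mem_ofPred_eq, Set.mem_image, Prod.mk.injEq]
    constructor
    · rintro ⟨h, rfl⟩; exact ⟨x, h, rfl, rfl⟩
    · rintro ⟨w, h, rfl, rfl⟩; exact ⟨h, rfl⟩
  rw [this, Set.ncard_image_of_injective _ (Prod.mk_left_injective v)]
  rfl

/-- The star of arcs of `D` leaving a vertex (left summand) or entering it (right summand). Every
arc lies in exactly two stars. -/
noncomputable def star [Fintype V] [DecidableEq V] (D : Digraph V) : V ⊕ V → Finset (V × V)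
  | .inl v => (arcs D).filter fun e => e.1 = v
  | .inr v => (arcs D).filter fun e => e.2 = v

section Star

variable [Fintype V] [DecidableEq V]

lemma star_subset (D : Digraph V) (i : V ⊕ V) : star D i ⊆ arcs D := by
  cases i <;> exact Finset.filter_subset _ _

lemma ncard_star_le_two (D : Digraph V) (e : V × V) : {i | e ∈ star D i}.ncard ≤ 2 := by
  have : {i | e ∈ star D i} ⊆ {Sum.inl e.1, Sum.inr e.2} := by
    rintro (v | v) h
    · simp [(Finset.mem_filter.1 h).2]
    · simp [(Finset.mem_filter.1 h).2]
  exact (Set.ncard_le_ncard this (Set.toFinite _)).trans ((Set.ncard_insert_le _ _).trans (by simp))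

lemma outDegree_ofArcs {D : Digraph V} {T : Finset (V × V)} (hT : T ⊆ arcs D) (v : V) :
    outDegree (ofArcs (T : Set (V × V))) v = (T ∩ star D (.inl v)).card := by
  rw [outDegree_eq_ncard, ← Set.ncard_coe_finset]
  congr 1
  ext e
  simp only [ofArcs, star, Set.mem_ofPred_eq, Finset.coe_inter, Set.mem_inter_iff,
    Finset.mem_coe, Finset.mem_filter]
  exact ⟨fun h => ⟨h.1, hT h.1, h.2⟩, fun h => ⟨h.1, h.2.2⟩⟩

lemma inDegree_ofArcs {D : Digraph V} {T : Finset (V × V)} (hT : T ⊆ arcs D) (v : V) :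
    inDegree (ofArcs (T : Set (V × V))) v = (T ∩ star D (.inr v)).card := by
  rw [inDegree_eq_ncard, ← Set.ncard_coe_finset]
  congr 1
  ext e
  simp only [ofArcs, star, Set.mem_ofPred_eq, Finset.coe_inter, Set.mem_inter_iff,
    Finset.mem_coe, Finset.mem_filter]
  exact ⟨fun h => ⟨h.1, hT h.1, h.2⟩, fun h => ⟨h.1, h.2.2⟩⟩

lemma minSemidegree_le_card_star (D : Digraph V) (i : V ⊕ V) :
    minSemidegree D ≤ (star D i).card := by
  have hD : ofArcs (arcs D : Set (V × V)) = D := by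
    ext v w
    exact mem_arcs (D := D) (e := (v, w))
  rcases i with v | v
  · have := outDegree_ofArcs (subset_refl (arcs D)) v
    rw [hD, Finset.inter_eq_right.2 (star_subset _ _)] at this
    rw [← this]
    exact (min_le_left _ _).trans (ciInf_le' _ v)
  · have := inDegree_ofArcs (subset_refl (arcs D)) v
    rw [hD, Finset.inter_eq_right.2 (star_subset _ _)] at this
    rw [← this]
    exact (min_le_right _ _).trans (ciInf_le' _ v)

/-- A digraph of local resilience more than `r` keeps the property, hence contains a winning set,
after the deletion of a proportion `r` of each star. -/
lemma exists_mem_winningSets {D : Digraph V} {P : Digraph V → Prop} {r : ℝ} (hr0 : 0 ≤ r)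
    (hr1 : r ≤ 1) {S Z : Finset (V × V)} (hS : S ⊆ arcs D) (hZ : Z ⊆ S)
    (hres : r < localResilience P (ofArcs (S : Set (V × V))))
    (hdeg : ∀ i, ((Z ∩ star D i).card : ℝ) ≤ r * (S ∩ star D i).card) :
    ∃ w ∈ winningSets D P, w ⊆ S \ Z := by
  have hP : P (ofArcs (S : Set (V × V)) \ ofArcs (Z : Set (V × V))) := by
    by_contra hcon
    refine hres.not_ge (csInf_le ⟨0, fun x hx => hx.1⟩ ⟨hr0, hr1, ofArcs (Z : Set (V × V)),
      fun v w h => hZ h, fun v => ?_, hcon⟩)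
    rw [outDegree_ofArcs hS, inDegree_ofArcs hS, outDegree_ofArcs (hZ.trans hS),
      inDegree_ofArcs (hZ.trans hS)]
    exact ⟨hdeg _, hdeg _⟩
  obtain ⟨K, hK, hKmin⟩ := (Set.toFinite {K : Digraph V | K ≤ D ∧ P K}).exists_le_minimal
    (a := ofArcs (S : Set (V × V)) \ ofArcs (Z : Set (V × V)))
    ⟨fun v w h => mem_arcs.1 (hS h.1), hP⟩
  refine ⟨arcs K, ⟨K, hKmin, rfl⟩, fun e he => ?_⟩
  have := hK (mem_arcs.1 he)
  exact Finset.mem_sdiff.2 ⟨this.1, this.2⟩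

end Star

end DirectedResilience

open DirectedResilience in
theorem theorem4p1 (ε : ℝ) (hε0 : 0 < ε) (hε1 : ε ≤ 1 / 100)
    (p : ℕ → unitInterval) (hp : ∀ n, 0 < (p n : ℝ) ∧ (p n : ℝ) < 1)
    (D : (n : ℕ) → Digraph (Fin n)) (hD : ∀ n, DirectedResilience.Loopless (D n))
    (P : (n : ℕ) → Digraph (Fin n) → Prop)
    (hP : ∀ n, DirectedResilience.MonotoneIncreasing (P n))
    (hres : DirectedResilience.Resilient D p ε P) :
    ∃ N : ℕ, ∀ n : ℕ, N ≤ n →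
      10 * Real.log n / (ε * p n) ≤ (DirectedResilience.minSemidegree (D n) : ℝ) →
      MakerBreaker.MakerWins (DirectedResilience.arcs (D n))
        (DirectedResilience.winningSets (D n) (P n)) 1 ⌊ε / (20 * p n)⌋₊ := by
  obtain ⟨N, hN⟩ := Filter.eventually_atTop.1 (hres.eventually (lt_mem_nhds (one_half_lt_one)))
  refine ⟨max N 9, fun n hn hdeg => ?_⟩
  obtain ⟨hp0, hp1⟩ := hp n
  have hn9 : 9 ≤ n := (le_max_right _ _).trans hn
  have hn9' : (9 : ℝ) ≤ n := by exact_mod_cast hn9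
  have hprob := hN n ((le_max_left _ _).trans hn)
  rw [randomSubdigraphProb, MakerBreaker.setBernoulli_real_eq_condProb] at hprob
  refine MakerBreaker.makerWins_of_condProb (star_subset (D n)) (ncard_star_le_two (D n))
    (fun e he => ⟨.inl e.1, Finset.mem_filter.2 ⟨he, rfl⟩⟩) hp0 hp1.le hε0 hε1 (ℓ := Real.log n)
    ?_ (fun i => ?_) ?_ (lt_of_le_of_lt ?_ hprob) ?_
  · rw [← le_div_iff₀ (by positivity)]
    exact Nat.floor_le (by positivity)
  · rw [← mul_assoc, ← div_le_iff₀' (by positivity)]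
    exact hdeg.trans (by exact_mod_cast minSemidegree_le_card_star (D n) i)
  · -- `1 + log (2 * n) ≤ 2 * log n` because `2 * exp 1 ≤ n`.
    refine (harmonic_le_one_add_log _).trans ?_
    rw [Fintype.card_sum, Fintype.card_fin, ← two_mul]
    push_cast
    rw [Real.log_mul two_ne_zero (by positivity)]
    have h1 : Real.log (Real.exp 1 * 2) ≤ Real.log n :=
      Real.log_le_log (by positivity) (by linarith [Real.exp_one_lt_d9])
    rw [Real.log_mul (Real.exp_pos 1).ne' two_ne_zero, Real.log_exp] at h1
    linarith
  · have h1 : Real.exp (-2 * Real.log n) = ((n : ℝ) ^ 2)⁻¹ := by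
      rw [neg_mul, Real.exp_neg, ← Nat.cast_ofNat (n := 2), ← Real.log_pow,
        Real.exp_log (by positivity)]
    rw [Fintype.card_sum, Fintype.card_fin, h1, ← div_eq_mul_inv, div_le_iff₀ (by positivity)]
    push_cast
    nlinarith
  · intro S hS hG Z hZ hcard
    exact exists_mem_winningSets (by positivity) (by linarith) hS hZ
      (lt_of_lt_of_le (by linarith) hG) hcard
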